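/- **Theorem 3.4.** *Definitions.* Let $f,g\in\mathbb{R}[x]$. If $f$ and $g$ are nonzero, real-rooted and have positive leading coefficients, let $\alpha_1\ge\alpha_2\ge\cdots$ and $\beta_1\ge\beta_2\ge\cdots$ be the zeros of $f$ and $g$, respectively, counted with multiplicity. Write $f\ll g$ if $\deg g\in\{\deg f,\deg f+1\}$ and $$\cdots\le\alpha_2\le\beta_2\le\alpha_1\le\beta_1 ;$$ in addition, $f\ll 0$ and $0\ll f$ by convention for every polynomial $f$. The zero polynomial counts as real-rooted. Let $\mathcal{F}_n^+$ be the set of all sequences $(f_1,\dots,f_n)$ of real-rooted polynomials in $\mathbb{R}[x]$ with nonnegative coefficients such that $f_i\ll f_j$ for all $1\le i<j\le n$. An $m\times n$ matrix $G=(G_{ki})$ of polynomials acts by $G\cdot(f_1,\dots,f_n)^T=(g_1,\dots,g_m)^T$ with $g_k=\sum_{i=1}^nG_{ki}f_i$. We write $G:\mathcal{F}_n^+\to\mathcal{F}_m^+$ if $G$ maps every element of $\mathcal{F}_n^+$ to an element of $\mathcal{F}_m^+$. *Statement.* Let $m,n\ge 2$ and let $G$ be an $m\times n$ matrix all of whose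 entries are in $\{0,1,x\}$. Suppose that no $2\times2$ submatrix $\begin{pmatrix}G_{ki}&G_{kj}\\G_{li}&G_{lj}\end{pmatrix}$ with $1\le k<l\le m$ and $1\le i<j\le n$ is of one of the following types, where $*$ stands for an arbitrary entry: i) $\begin{pmatrix}x&*\\1&*\end{pmatrix}$ or $\begin{pmatrix}*&x\\ *&1\end{pmatrix}$; ii) $\begin{pmatrix}1&x\\ *&*\end{pmatrix}$ or $\begin{pmatrix}*&*\\1&x\end{pmatrix}$; iii) $\begin{pmatrix}1&*\\ *&x\end{pmatrix}$, $\begin{pmatrix}x&*\\ *&1\end{pmatrix}$ or $\begin{pmatrix}*&x\\1&*\end{pmatrix}$, except for $\begin{pmatrix}1&1\\x&x\end{pmatrix}$ and $\begin{pmatrix}x&1\\x&1\end{pmatrix}$; iv) a matrix with all entries $0$ or $1$ and negative determinant; v) $x$ times a matrix with all entries $0$ or $1$ and negative determinant. Then $G:\mathcal{F}_n^+\to\mathcal{F}_m^+$. -/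

import Mathlib

open Polynomial

noncomputable section

/-- The real zeros of `f`, counted with multiplicity, listed in weakly decreasing order
(`zerosDesc f` has entries `α₁ ≥ α₂ ≥ ⋯`, with the index shifted to start at `0`). -/
def zerosDesc (f : ℝ[X]) : List ℝ := f.roots.sort (fun a b => b ≤ a)

/-- `f ≪ g`: `f` is an interleaver of `g`. By convention `f ≪ 0` and `0 ≪ g`. Otherwise `f` and `g`
are real-rooted with positive leading coefficients and their zeros `α₁ ≥ α₂ ≥ ⋯` (of `f`) and
`β₁ ≥ β₂ ≥ ⋯` (of `g`) satisfy `⋯ ≤ α₂ ≤ β₂ ≤ α₁ ≤ β₁`; the chain runs through all zeros of both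
polynomials, so `g` has either as many zeros as `f` or exactly one more. -/
def Interleaves (f g : ℝ[X]) : Prop :=
  f = 0 ∨ g = 0 ∨
    (f.Splits ∧ g.Splits ∧ 0 < f.leadingCoeff ∧ 0 < g.leadingCoeff ∧
      ((zerosDesc g).length = (zerosDesc f).length ∨
        (zerosDesc g).length = (zerosDesc f).length + 1) ∧
      (∀ (i : ℕ) (hf : i < (zerosDesc f).length) (hg : i < (zerosDesc g).length),
        (zerosDesc f)[i] ≤ (zerosDesc g)[i]) ∧
      (∀ (i : ℕ) (hf : i < (zerosDesc f).length) (hg : i + 1 < (zerosDesc g).length),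
        (zerosDesc g)[i + 1] ≤ (zerosDesc f)[i]))

/-- The family of all interlacing sequences of `n` polynomials: real-rooted (the zero polynomial is
allowed, as `Polynomial.Splits` does) with `f i ≪ f j` for all `i < j`. -/
def interlacingFamily (n : ℕ) : Set (Fin n → ℝ[X]) :=
  {f | (∀ i, (f i).Splits) ∧ ∀ i j, i < j → Interleaves (f i) (f j)}

/-- The interlacing sequences of `n` polynomials all of which have nonnegative coefficients. -/
def interlacingFamilyNonneg (n : ℕ) : Set (Fin n → ℝ[X]) :=
  {f | f ∈ interlacingFamily n ∧ ∀ i k, 0 ≤ (f i).coeff k}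

/-- The forbidden `2 × 2` matrices of polynomials, by type. -/
inductive IsForbidden : Matrix (Fin 2) (Fin 2) ℝ[X] → Prop
  /-- type i), first form -/
  | col_left (b d : ℝ[X]) : IsForbidden !![X, b; 1, d]
  /-- type i), second form -/
  | col_right (a c : ℝ[X]) : IsForbidden !![a, X; c, 1]
  /-- type ii), first form -/
  | row_top (c d : ℝ[X]) : IsForbidden !![1, X; c, d]
  /-- type ii), second form -/
  | row_bottom (a b : ℝ[X]) : IsForbidden !![a, b; 1, X]
  /-- type iii), first form -/
  | diag_one_X (b c : ℝ[X]) (h : ¬ (b = 1 ∧ c = X)) : IsForbidden !![1, b; c, X]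
  /-- type iii), second form -/
  | diag_X_one (b c : ℝ[X]) (h : ¬ (b = 1 ∧ c = X)) : IsForbidden !![X, b; c, 1]
  /-- type iii), third form -/
  | antidiag (a d : ℝ[X]) : IsForbidden !![a, X; 1, d]
  /-- type iv) -/
  | zero_one (B : Matrix (Fin 2) (Fin 2) ℝ) (hB : ∀ i j, B i j = 0 ∨ B i j = 1)
      (hdet : B.det < 0) : IsForbidden (B.map C)
  /-- type v) -/
  | X_mul_zero_one (B : Matrix (Fin 2) (Fin 2) ℝ) (hB : ∀ i j, B i j = 0 ∨ B i j = 1)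
      (hdet : B.det < 0) : IsForbidden ((X : ℝ[X]) • B.map C)

end

/-! For nonzero real-rooted `f`, `g` with positive leading coefficients, `f ≪ g` means that the
numbers of zeros in `[t, ∞)` satisfy `N_f ≤ N_g ≤ N_f + 1` for all `t`. Two facts carry the proof.
The `f` with `f ≪ g` for a fixed `g` are closed under addition (`Interleaves.add_left`), because the
signs of all such `f` at the zeros of `g` agree. For nonnegative coefficients, `f ≪ g` is equivalent
to `g ≪ x f` (`interleaves_X_mul_iff`), which transfers additivity to the right-hand side. Thus a
relation between two sums follows from the relations between their terms.

Two rows of `G` are compared by sorting columns: equal entries, entry `1` above `x`, and the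
remaining columns, in which one entry is `0`. Each row becomes a sum of three blocks. Of the nine
relations between blocks, seven hold term by term by a finite check on admissible `2 × 2` patterns;
the other two are `p ≪ p` and `p ≪ x p` for a real-rooted block `p`. -/

/-- The number of real zeros of `f` in `[t, ∞)`, with multiplicity. -/
noncomputable def zerosGe (f : ℝ[X]) (t : ℝ) : ℕ := f.roots.countP (t ≤ ·)

/-- The number of real zeros of `f` in `(t, ∞)`, with multiplicity. -/
noncomputable def zerosGt (f : ℝ[X]) (t : ℝ) : ℕ := f.roots.countP (t < ·)

/-- Interlacing of real-rooted polynomials with positive leading coefficients, in terms of the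
zero counting functions. -/
structure CountInterleaves (f g : ℝ[X]) : Prop where
  splits_left : f.Splits
  splits_right : g.Splits
  lc_left : 0 < f.leadingCoeff
  lc_right : 0 < g.leadingCoeff
  le (t : ℝ) : zerosGe f t ≤ zerosGe g t
  le_succ (t : ℝ) : zerosGe g t ≤ zerosGe f t + 1

/-! ### Interlacing through zero counting -/

/-- In a decreasing list the entries with an upward closed property form an initial segment. -/
theorem List.lt_countP_iff_of_pairwise_ge {L : List ℝ} (hL : L.Pairwise (fun a b => b ≤ a))
    (p : ℝ → Prop) [DecidablePred p] (hp : ∀ x y, x ≤ y → p x → p y) (i : ℕ) :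
    i < L.countP p ↔ ∃ h : i < L.length, p L[i] := by
  induction L generalizing i with
  | nil => simp
  | cons a l ih =>
    obtain ⟨ha, hl⟩ := List.pairwise_cons.1 hL
    by_cases hpa : p a
    · rw [List.countP_cons_of_pos (by simpa using hpa)]
      cases i with
      | zero => simp [hpa]
      | succ i => simpa using ih hl i
    · have hnone : ∀ x ∈ a :: l, ¬ p x := by
        intro x hx h
        rcases List.mem_cons.1 hx with rfl | hx
        · exact hpa h
        · exact hpa (hp _ _ (ha x hx) h)
      have h0 : (a :: l).countP p = 0 := by
        rw [List.countP_eq_zero]; simpa using hnone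
      rw [h0]
      simp only [Nat.not_lt_zero, false_iff, not_exists]
      exact fun h => hnone _ (List.getElem_mem h)

theorem zerosDesc_pairwise (f : ℝ[X]) : (zerosDesc f).Pairwise (fun a b => b ≤ a) :=
  Multiset.pairwise_sort _ _

theorem length_zerosDesc (f : ℝ[X]) : (zerosDesc f).length = f.roots.card :=
  Multiset.length_sort _

theorem countP_zerosDesc (f : ℝ[X]) (p : ℝ → Prop) [DecidablePred p] :
    (zerosDesc f).countP p = f.roots.countP p := by
  rw [← Multiset.coe_countP, zerosDesc, Multiset.sort_eq]

theorem exists_forall_roots_gt (f : ℝ[X]) (B : ℝ) : ∃ t < B, ∀ x ∈ f.roots, t < x := by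
  obtain ⟨m, hm⟩ := f.roots.toFinset.bddBelow
  refine ⟨min m B - 1, by linarith [min_le_right m B], fun x hx => ?_⟩
  have : m ≤ x := hm (by simpa using hx)
  linarith [min_le_left m B]

theorem zerosGe_of_forall_le {f : ℝ[X]} {t : ℝ} (h : ∀ x ∈ f.roots, t ≤ x) :
    zerosGe f t = f.roots.card := Multiset.countP_eq_card.2 h

theorem zerosGe_le_card (f : ℝ[X]) (t : ℝ) : zerosGe f t ≤ f.roots.card :=
  Multiset.countP_le_card _ _

namespace CountInterleaves

variable {f g : ℝ[X]}

theorem ne_zero_left (h : CountInterleaves f g) : f ≠ 0 := by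
  rintro rfl; simpa using h.lc_left

theorem ne_zero_right (h : CountInterleaves f g) : g ≠ 0 := by
  rintro rfl; simpa using h.lc_right

theorem card_roots (h : CountInterleaves f g) :
    f.roots.card ≤ g.roots.card ∧ g.roots.card ≤ f.roots.card + 1 := by
  obtain ⟨s, -, hs⟩ := exists_forall_roots_gt f 0
  obtain ⟨t, hts, ht⟩ := exists_forall_roots_gt g s
  have h1 := h.le t
  have h2 := h.le_succ t
  rw [zerosGe_of_forall_le fun x hx => (hts.trans (hs x hx)).le,
    zerosGe_of_forall_le fun x hx => (ht x hx).le] at h1 h2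
  exact ⟨h1, h2⟩

theorem natDegree (h : CountInterleaves f g) :
    f.natDegree ≤ g.natDegree ∧ g.natDegree ≤ f.natDegree + 1 := by
  rw [h.splits_left.natDegree_eq_card_roots, h.splits_right.natDegree_eq_card_roots]
  exact h.card_roots

/-- Each inequality of the chain is a count inequality evaluated at the zero that should be the
smaller one. -/
theorem chain (h : CountInterleaves f g) :
    (∀ (i : ℕ) (hf : i < (zerosDesc f).length) (hg : i < (zerosDesc g).length),
        (zerosDesc f)[i] ≤ (zerosDesc g)[i]) ∧
      (∀ (i : ℕ) (hf : i < (zerosDesc f).length) (hg : i + 1 < (zerosDesc g).length),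
        (zerosDesc g)[i + 1] ≤ (zerosDesc f)[i]) := by
  have key (u : ℝ[X]) (t : ℝ) (i : ℕ) :
      i < zerosGe u t ↔ ∃ h : i < (zerosDesc u).length, t ≤ (zerosDesc u)[i] := by
    rw [zerosGe, ← countP_zerosDesc]
    exact List.lt_countP_iff_of_pairwise_ge (zerosDesc_pairwise u) (t ≤ ·)
      (fun x y hxy hx => hx.trans hxy) i
  constructor
  · intro i hf hg
    have h1 := (key f (zerosDesc f)[i] i).2 ⟨hf, le_rfl⟩
    exact ((key g _ i).1 (h1.trans_le (h.le _))).2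
  · intro i hf hg
    have h1 := (key g (zerosDesc g)[i + 1] (i + 1)).2 ⟨hg, le_rfl⟩
    have h2 := h.le_succ (zerosDesc g)[i + 1]
    exact ((key f _ i).1 (by omega)).2

theorem interleaves (h : CountInterleaves f g) : Interleaves f g := by
  refine Or.inr (Or.inr ⟨h.splits_left, h.splits_right, h.lc_left, h.lc_right, ?_, h.chain⟩)
  rw [length_zerosDesc, length_zerosDesc]
  have := h.card_roots
  omega

end CountInterleaves

/-- A general upward closed `p` covers both closed and open half-lines. -/
theorem Interleaves.countP {f g : ℝ[X]} (h : Interleaves f g) (hf : f ≠ 0) (hg : g ≠ 0)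
    (p : ℝ → Prop) [DecidablePred p] (hp : ∀ x y, x ≤ y → p x → p y) :
    f.roots.countP p ≤ g.roots.countP p ∧ g.roots.countP p ≤ f.roots.countP p + 1 := by
  obtain h | h | ⟨-, -, -, -, hlen, hle, hsucc⟩ := h
  · exact absurd h hf
  · exact absurd h hg
  have key (u : ℝ[X]) (i : ℕ) :
      i < u.roots.countP p ↔ ∃ h : i < (zerosDesc u).length, p (zerosDesc u)[i] := by
    rw [← countP_zerosDesc]
    exact List.lt_countP_iff_of_pairwise_ge (zerosDesc_pairwise u) p hp i
  constructor
  · refine le_of_forall_lt fun i hi => ?_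
    obtain ⟨hif, hpi⟩ := (key f i).1 hi
    have hig : i < (zerosDesc g).length := by omega
    exact (key g i).2 ⟨hig, hp _ _ (hle i hif hig) hpi⟩
  · by_contra! hlt
    obtain ⟨hig, hpi⟩ := (key g _).1 hlt
    have hif : f.roots.countP p < (zerosDesc f).length := by omega
    exact lt_irrefl _ ((key f _).2 ⟨hif, hp _ _ (hsucc _ hif hig) hpi⟩)

theorem interleaves_iff {f g : ℝ[X]} :
    Interleaves f g ↔ f = 0 ∨ g = 0 ∨ CountInterleaves f g := by
  constructor
  · intro h
    by_cases hf : f = 0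
    · exact Or.inl hf
    by_cases hg : g = 0
    · exact Or.inr (Or.inl hg)
    have hc (t : ℝ) := h.countP hf hg (t ≤ ·) (fun x y hxy hx => hx.trans hxy)
    obtain h | h | ⟨h1, h2, h3, h4, -⟩ := h
    · exact absurd h hf
    · exact absurd h hg
    · exact Or.inr (Or.inr ⟨h1, h2, h3, h4, fun t => (hc t).1, fun t => (hc t).2⟩)
  · rintro (h | h | h)
    · exact Or.inl h
    · exact Or.inr (Or.inl h)
    · exact h.interleaves

/-! ### Multiplication by linear factors -/

theorem zerosGe_X_sub_C_mul (a : ℝ) {f : ℝ[X]} (hf : f ≠ 0) (t : ℝ) :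
    zerosGe ((X - C a) * f) t = zerosGe f t + if t ≤ a then 1 else 0 := by
  rw [zerosGe, roots_mul (mul_ne_zero (X_sub_C_ne_zero a) hf), roots_X_sub_C,
    Multiset.singleton_add, Multiset.countP_cons, zerosGe]

theorem countInterleaves_X_sub_C_mul_iff (a : ℝ) {f g : ℝ[X]} :
    CountInterleaves ((X - C a) * f) ((X - C a) * g) ↔ CountInterleaves f g := by
  by_cases hf : f = 0
  · subst hf
    constructor <;> intro h <;> exact absurd (by simp) h.ne_zero_left
  by_cases hg : g = 0
  · subst hg
    constructor <;> intro h <;> exact absurd (by simp) h.ne_zero_right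
  constructor
  · intro h
    refine ⟨splits_X_sub_C_mul_iff.1 h.1, splits_X_sub_C_mul_iff.1 h.2, by simpa using h.3,
      by simpa using h.4, fun t => ?_, fun t => ?_⟩
    · have := h.le t
      rw [zerosGe_X_sub_C_mul _ hf, zerosGe_X_sub_C_mul _ hg] at this
      omega
    · have := h.le_succ t
      rw [zerosGe_X_sub_C_mul _ hf, zerosGe_X_sub_C_mul _ hg] at this
      omega
  · intro h
    refine ⟨splits_X_sub_C_mul_iff.2 h.1, splits_X_sub_C_mul_iff.2 h.2, by simpa using h.3,
      by simpa using h.4, fun t => ?_, fun t => ?_⟩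
    · have := h.le t
      rw [zerosGe_X_sub_C_mul _ hf, zerosGe_X_sub_C_mul _ hg]
      omega
    · have := h.le_succ t
      rw [zerosGe_X_sub_C_mul _ hf, zerosGe_X_sub_C_mul _ hg]
      omega

theorem zerosGe_X_mul {f : ℝ[X]} (hf : f ≠ 0) (t : ℝ) :
    zerosGe (X * f) t = zerosGe f t + if t ≤ 0 then 1 else 0 := by
  simpa using zerosGe_X_sub_C_mul 0 hf t

theorem Interleaves.X_mul {f g : ℝ[X]} (h : Interleaves f g) : Interleaves (X * f) (X * g) := by
  rw [interleaves_iff] at h ⊢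
  obtain rfl | rfl | h := h
  · simp
  · simp
  · exact Or.inr (Or.inr (by simpa using (countInterleaves_X_sub_C_mul_iff 0).2 h))

theorem leadingCoeff_pos_of_coeff_nonneg {f : ℝ[X]} (hf : ∀ k, 0 ≤ f.coeff k) (h : f ≠ 0) :
    0 < f.leadingCoeff :=
  lt_of_le_of_ne (hf _) (leadingCoeff_ne_zero.2 h).symm

theorem nonpos_of_mem_roots {f : ℝ[X]} (hf : ∀ k, 0 ≤ f.coeff k) {x : ℝ} (hx : x ∈ f.roots) :
    x ≤ 0 := by
  by_contra! hpos
  obtain ⟨h0, hr⟩ := mem_roots'.1 hx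
  have hlc := leadingCoeff_pos_of_coeff_nonneg hf h0
  rw [IsRoot, eval_eq_sum_range, Finset.sum_eq_zero_iff_of_nonneg
    fun i _ => mul_nonneg (hf i) (pow_nonneg hpos.le i)] at hr
  have := hr f.natDegree (by simp)
  exact (mul_pos hlc (pow_pos hpos _)).ne' this

theorem zerosGe_eq_zero_of_pos {f : ℝ[X]} (hf : ∀ k, 0 ≤ f.coeff k) {t : ℝ} (ht : 0 < t) :
    zerosGe f t = 0 :=
  Multiset.countP_eq_zero.2 fun _ hx => not_le.2 ((nonpos_of_mem_roots hf hx).trans_lt ht)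

theorem Interleaves.refl {f : ℝ[X]} (hs : f.Splits) (hf : ∀ k, 0 ≤ f.coeff k) :
    Interleaves f f := by
  rw [interleaves_iff]
  by_cases h : f = 0
  · exact Or.inl h
  have := leadingCoeff_pos_of_coeff_nonneg hf h
  exact Or.inr (Or.inr ⟨hs, hs, this, this, fun _ => le_rfl, fun _ => Nat.le_succ _⟩)

/-- For polynomials with nonnegative coefficients, `f ≪ g` if and only if `g ≪ x f`. -/
theorem interleaves_X_mul_iff {f g : ℝ[X]} (hf : ∀ k, 0 ≤ f.coeff k) (hg : ∀ k, 0 ≤ g.coeff k) :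
    Interleaves g (X * f) ↔ Interleaves f g := by
  by_cases hf0 : f = 0
  · subst hf0; simp [Interleaves]
  by_cases hg0 : g = 0
  · subst hg0; simp [Interleaves]
  -- For `t ≤ 0` the extra zero of `x f` swaps the two inequalities; for `t > 0` all counts vanish.
  have hcount (t : ℝ) : (zerosGe g t ≤ zerosGe (X * f) t ∧ zerosGe (X * f) t ≤ zerosGe g t + 1) ↔
      (zerosGe f t ≤ zerosGe g t ∧ zerosGe g t ≤ zerosGe f t + 1) := by
    rw [zerosGe_X_mul hf0]
    split_ifs with h
    · omega
    · rw [zerosGe_eq_zero_of_pos hf (not_le.1 h), zerosGe_eq_zero_of_pos hg (not_le.1 h)]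
  have hsplit : (X * f).Splits ↔ f.Splits := by
    simp
  rw [interleaves_iff, interleaves_iff, or_iff_right hg0, or_iff_right hf0, or_iff_right hg0,
    or_iff_right (mul_ne_zero X_ne_zero hf0)]
  constructor
  · intro h
    exact ⟨hsplit.1 h.2, h.1, by simpa using h.4, h.3, fun t => ((hcount t).1 ⟨h.5 t, h.6 t⟩).1,
      fun t => ((hcount t).1 ⟨h.5 t, h.6 t⟩).2⟩
  · intro h
    exact ⟨h.2, hsplit.2 h.1, h.4, by simpa using h.3, fun t => ((hcount t).2 ⟨h.5 t, h.6 t⟩).1,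
      fun t => ((hcount t).2 ⟨h.5 t, h.6 t⟩).2⟩

/-! ### Signs and sign changes -/

theorem neg_one_pow_countP_mul_prod_pos (s : Multiset ℝ) (t : ℝ) (ht : t ∉ s) :
    0 < (-1) ^ s.countP (t < ·) * (s.map (t - ·)).prod := by
  induction s using Multiset.induction_on with
  | empty => simp
  | cons a s ih =>
    rw [Multiset.mem_cons, not_or] at ht
    have h := ih ht.2
    rw [Multiset.countP_cons, Multiset.map_cons, Multiset.prod_cons]
    split_ifs with hta
    · have := mul_pos (sub_pos.2 hta) h
      rw [pow_succ]
      linarith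
    · have := mul_pos (sub_pos.2 (lt_of_le_of_ne (not_lt.1 hta) (Ne.symm ht.1))) h
      rw [add_zero]
      linarith

/-- Off its zeros, the sign of a real-rooted polynomial with positive leading coefficient is given
by the number of larger zeros. -/
theorem neg_one_pow_zerosGt_mul_eval_pos {f : ℝ[X]} (hs : f.Splits) (hlc : 0 < f.leadingCoeff)
    {t : ℝ} (ht : f.eval t ≠ 0) : 0 < (-1) ^ zerosGt f t * f.eval t := by
  have h := neg_one_pow_countP_mul_prod_pos f.roots t fun h => ht (mem_roots'.1 h).2
  rw [hs.eval_eq_prod_roots, zerosGt]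
  have := mul_pos hlc h
  linarith

theorem zerosGe_eq_zerosGt_add_count (f : ℝ[X]) (t : ℝ) :
    zerosGe f t = zerosGt f t + f.roots.count t := by
  rw [zerosGe, zerosGt]
  induction f.roots using Multiset.induction_on with
  | empty => simp
  | cons a s ih =>
    rw [Multiset.countP_cons, Multiset.countP_cons, Multiset.count_cons, ih]
    rcases lt_trichotomy t a with h | rfl | h
    · simp only [h, h.le, h.ne, if_true, if_false]; omega
    · simp only [le_refl, lt_irrefl, if_true, if_false]; omega
    · simp only [h.not_ge, h.not_gt, h.ne', if_false]; omega

theorem CountInterleaves.zerosGt_le {f g : ℝ[X]} (h : CountInterleaves f g) (t : ℝ) :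
    zerosGt f t ≤ zerosGt g t :=
  (h.interleaves.countP h.ne_zero_left h.ne_zero_right (t < ·)
    fun _ _ hxy hx => hx.trans_le hxy).1

/-- A polynomial interlacing `g` weakly alternates in sign at the zeros of `g`, and vanishes at the
multiple ones. -/
theorem CountInterleaves.sign_at_root {f g : ℝ[X]} (h : CountInterleaves f g) {b : ℝ}
    (hb : b ∈ g.roots) (hf : f.eval b ≠ 0) :
    0 < (-1) ^ zerosGt g b * f.eval b ∧ g.roots.count b ≤ 1 := by
  have h0 : f.roots.count b = 0 := Multiset.count_eq_zero.2 fun h => hf (mem_roots'.1 h).2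
  have h1 := h.zerosGt_le b
  have h2 := h.le_succ b
  rw [zerosGe_eq_zerosGt_add_count, zerosGe_eq_zerosGt_add_count, h0] at h2
  have h3 : 1 ≤ g.roots.count b := Multiset.one_le_count_iff_mem.2 hb
  -- The multiplicity of `b` in `g` is at least one, so the bounds leave no slack: it equals one and
  -- the counts above `b` agree.
  have h4 : zerosGt g b = zerosGt f b := by omega
  exact ⟨h4 ▸ neg_one_pow_zerosGt_mul_eval_pos h.splits_left h.lc_left hf, by omega⟩

theorem exists_root_Ioo_of_mul_neg (F : ℝ[X]) {x y : ℝ} (hxy : x < y)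
    (h : F.eval x * F.eval y < 0) : ∃ z, x < z ∧ z < y ∧ F.IsRoot z := by
  have hc : ContinuousOn (fun z => F.eval z) (Set.Icc x y) := F.continuous.continuousOn
  rcases mul_neg_iff.1 h with ⟨h1, h2⟩ | ⟨h1, h2⟩
  · obtain ⟨z, hz, hz0⟩ := intermediate_value_Ioo' hxy.le hc ⟨h2, h1⟩
    exact ⟨z, hz.1, hz.2, hz0⟩
  · obtain ⟨z, hz, hz0⟩ := intermediate_value_Ioo hxy.le hc ⟨h1, h2⟩
    exact ⟨z, hz.1, hz.2, hz0⟩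

/-- If `F` alternates in sign along the finite set `S`, then it has a zero between any two
consecutive elements of `S`. -/
theorem card_filter_le_card_roots_filter (F : ℝ[X]) (hF : F ≠ 0) (S : Finset ℝ)
    (hS : ∀ y ∈ S, 0 < (-1) ^ (S.filter (y < ·)).card * F.eval y)
    (p : ℝ → Prop) [DecidablePred p] (hp : ∀ x y z, x ≤ y → y ≤ z → p x → p z → p y) :
    (S.filter p).card ≤ F.roots.countP p + 1 := by
  have key : (S.filter p).card ≤ (F.roots.toFinset.filter p).card + 1 := by
    refine Finset.card_le_of_interleaved fun x hx y hy hxy hno => ?_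
    rw [Finset.mem_filter] at hx hy
    -- Convexity of `p` makes `x` and `y` consecutive in all of `S`, so their exponents differ by
    -- one.
    have hins : S.filter (x < ·) = insert y (S.filter (y < ·)) := by
      ext z
      simp only [Finset.mem_filter, Finset.mem_insert]
      constructor
      · rintro ⟨hz, hxz⟩
        rcases lt_trichotomy z y with hzy | rfl | hzy
        · exact absurd ⟨hxz, hzy⟩
            (hno z (Finset.mem_filter.2 ⟨hz, hp _ _ _ hxz.le hzy.le hx.2 hy.2⟩))
        · exact Or.inl rfl
        · exact Or.inr ⟨hz, hzy⟩
      · rintro (rfl | ⟨hz, hyz⟩)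
        · exact ⟨hy.1, hxy⟩
        · exact ⟨hz, hxy.trans hyz⟩
    have h1 := hS x hx.1
    have h2 := hS y hy.1
    rw [hins, Finset.card_insert_of_notMem (by simp), pow_succ] at h1
    have h3 : F.eval x * F.eval y < 0 := by
      rcases neg_one_pow_eq_or ℝ (S.filter (y < ·)).card with h | h <;> rw [h] at h1 h2 <;>
        nlinarith
    obtain ⟨z, hxz, hzy, hz⟩ := exists_root_Ioo_of_mul_neg F hxy h3
    refine ⟨z, ?_, hxz, hzy⟩
    rw [Finset.mem_filter, Multiset.mem_toFinset]
    exact ⟨(mem_roots hF).2 hz, hp _ _ _ hxz.le hzy.le hx.2 hy.2⟩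
  refine key.trans (Nat.succ_le_succ ?_)
  rw [Multiset.countP_eq_card_filter, ← Multiset.toFinset_filter]
  exact Multiset.toFinset_card_le _

theorem exists_lt_sign_atBot (F : ℝ[X]) (hF : 0 < F.leadingCoeff) (B : ℝ) :
    ∃ y < B, 0 < (-1) ^ F.natDegree * F.eval y := by
  by_cases hdeg : F.natDegree = 0
  · refine ⟨B - 1, by linarith, ?_⟩
    rw [hdeg, eq_C_of_natDegree_eq_zero hdeg, eval_C, pow_zero, one_mul]
    rwa [leadingCoeff, hdeg] at hF
  -- Reflection turns behaviour at `-∞` into behaviour at `+∞`; the sign keeps the leading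
  -- coefficient.
  set Q : ℝ[X] := C ((-1) ^ F.natDegree) * F.comp (-X) with hQ
  have hlc : Q.leadingCoeff = F.leadingCoeff := by
    rw [hQ, leadingCoeff_mul, leadingCoeff_C, leadingCoeff_comp (by simp), leadingCoeff_neg,
      leadingCoeff_X, mul_comm, mul_assoc, ← mul_pow]
    simp
  have hQdeg : Q.natDegree = F.natDegree := by
    rw [hQ, natDegree_C_mul (by simp), natDegree_comp]; simp
  have ht := Q.tendsto_atTop_of_leadingCoeff_nonneg
    (natDegree_pos_iff_degree_pos.1 (by omega)) (hlc ▸ hF.le)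
  obtain ⟨x, hx, hxB⟩ := ((ht.eventually_gt_atTop 0).and (Filter.eventually_gt_atTop (-B))).exists
  refine ⟨-x, by linarith, ?_⟩
  simpa [hQ] using hx

/-- A polynomial which strictly alternates in sign at the simple zeros of `g`. -/
theorem CountInterleaves.of_sign_at_roots {F g : ℝ[X]} (hg : g.Splits) (hlc : 0 < g.leadingCoeff)
    (hF : 0 < F.leadingCoeff)
    (hdeg : F.natDegree ≤ g.natDegree ∧ g.natDegree ≤ F.natDegree + 1)
    (hnodup : g.roots.Nodup) (hsign : ∀ b ∈ g.roots, 0 < (-1) ^ zerosGt g b * F.eval b) :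
    CountInterleaves F g := by
  have hF0 : F ≠ 0 := by rintro rfl; simp at hF
  have hcardF := F.card_roots'
  have hgcard := hg.natDegree_eq_card_roots
  set R := g.roots.toFinset with hR
  have hcount (p : ℝ → Prop) [DecidablePred p] : g.roots.countP p = (R.filter p).card := by
    rw [Multiset.countP_eq_card_filter, hR, ← Multiset.toFinset_filter,
      Multiset.toFinset_card_of_nodup (hnodup.filter _)]
  have hRcard : R.card = g.natDegree := by
    rw [hgcard, hR, Multiset.toFinset_card_of_nodup hnodup]
  have hRsign : ∀ y ∈ R, 0 < (-1) ^ (R.filter (y < ·)).card * F.eval y := by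
    intro y hy
    rw [← hcount]
    exact hsign y (by simpa [hR] using hy)
  -- Alternation at `deg F + 1` points forces `deg F` real zeros. The zeros of `g` suffice if `deg g
  -- = deg F + 1`; for equal degrees a point far to the left is added.
  obtain ⟨S, hRS, hScard, hSsign, hlow⟩ : ∃ S : Finset ℝ, R ⊆ S ∧ S.card = F.natDegree + 1 ∧
      (∀ y ∈ S, 0 < (-1) ^ (S.filter (y < ·)).card * F.eval y) ∧
      (∀ y ∈ S, y ∉ R → ∀ z ∈ R, y < z) := by
    by_cases hd : g.natDegree = F.natDegree + 1
    · exact ⟨R, subset_rfl, by omega, hRsign, fun y hy hy' => absurd hy hy'⟩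
    have hd' : g.natDegree = F.natDegree := by omega
    obtain ⟨B, -, hB⟩ := exists_forall_roots_gt g 0
    obtain ⟨y, hyB, hy⟩ := exists_lt_sign_atBot F hF B
    have hyR : ∀ z ∈ R, y < z := fun z hz => hyB.trans (hB z (by simpa [hR] using hz))
    have hynot : y ∉ R := fun h => lt_irrefl _ (hyR y h)
    refine ⟨insert y R, Finset.subset_insert _ _, ?_, ?_, ?_⟩
    · rw [Finset.card_insert_of_notMem hynot]; omega
    · intro z hz
      rcases Finset.mem_insert.1 hz with rfl | hz
      · rw [Finset.filter_insert, if_neg (lt_irrefl _), Finset.filter_true_of_mem hyR, hRcard, hd']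
        exact hy
      · rw [Finset.filter_insert, if_neg (hyR z hz).not_gt]
        exact hRsign z hz
    · intro z hz hzR
      rcases Finset.mem_insert.1 hz with rfl | hz
      · exact hyR
      · exact absurd hz hzR
  have hFs : F.Splits := by
    rw [splits_iff_card_roots]
    have := card_filter_le_card_roots_filter F hF0 S hSsign (fun _ => True) (by simp)
    rw [Finset.filter_true, Multiset.countP_True] at this
    omega
  refine ⟨hFs, hg, hF, hlc, fun t => ?_, fun t => ?_⟩
  · by_cases hall : ∀ z ∈ R, t ≤ z
    · rw [zerosGe_of_forall_le (f := g) fun x hx => hall x (by simpa [hR] using hx)]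
      exact (zerosGe_le_card F t).trans (by omega)
    push Not at hall
    obtain ⟨z, hz, hzt⟩ := hall
    -- The zeros of `F` below `t` are bounded from below, which bounds those in `[t, ∞)` from above.
    -- An added point of `S` lies below `t`, being smaller than `z`.
    have h1 := card_filter_le_card_roots_filter F hF0 S hSsign (fun x => ¬ t ≤ x)
      (fun x y z _ hyz _ hz h => hz (h.trans hyz))
    have h2 : (S.filter (t ≤ ·)) = R.filter (t ≤ ·) := by
      ext y
      simp only [Finset.mem_filter, and_congr_left_iff]
      intro hty
      refine ⟨fun hy => ?_, fun hy => hRS hy⟩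
      by_contra hyR
      linarith [hlow y hy hyR z hz]
    have h3 := S.card_filter_add_card_filter_not (t ≤ ·)
    have h4 := F.roots.card_eq_countP_add_countP (t ≤ ·)
    rw [zerosGe, zerosGe, hcount, ← h2]
    omega
  · have h1 := card_filter_le_card_roots_filter F hF0 R hRsign (t ≤ ·)
      (fun x y z hxy _ hx _ => hx.trans hxy)
    rw [zerosGe, hcount]
    exact h1

/-! ### Additivity of interlacing -/

theorem leadingCoeff_add_pos {f g : ℝ[X]} (hf : 0 < f.leadingCoeff) (hg : 0 < g.leadingCoeff) :
    0 < (f + g).leadingCoeff ∧ (f + g).natDegree = max f.natDegree g.natDegree := by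
  rcases lt_trichotomy f.degree g.degree with h | h | h
  · rw [leadingCoeff_add_of_degree_lt h, natDegree_add_eq_right_of_degree_lt h]
    exact ⟨hg, (max_eq_right (natDegree_le_natDegree h.le)).symm⟩
  · have hne : f.leadingCoeff + g.leadingCoeff ≠ 0 := by positivity
    rw [leadingCoeff_add_of_degree_eq h hne]
    refine ⟨by positivity, ?_⟩
    have hd : (f + g).degree = f.degree := by
      rw [degree_add_eq_of_leadingCoeff_add_ne_zero hne, ← h, max_self]
    rw [natDegree_eq_of_degree_eq hd, ← natDegree_eq_of_degree_eq h, max_self]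
  · rw [leadingCoeff_add_of_degree_lt' h, natDegree_add_eq_left_of_degree_lt h]
    exact ⟨hf, (max_eq_left (natDegree_le_natDegree h.le)).symm⟩

/-- The polynomials interlacing `g` form a convex cone. -/
theorem CountInterleaves.add_left {f₁ f₂ g : ℝ[X]} (h₁ : CountInterleaves f₁ g)
    (h₂ : CountInterleaves f₂ g) : CountInterleaves (f₁ + f₂) g := by
  induction hd : g.natDegree using Nat.strong_induction_on generalizing f₁ f₂ g with
  | _ d ih =>
  have hg0 := h₁.ne_zero_right
  -- A zero common to all three is divided out. Otherwise at each zero of `g` some summand is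
  -- nonzero, with the sign dictated by `g`, so the sum alternates strictly and `g` has simple
  -- zeros.
  by_cases hcommon : ∃ b, f₁.IsRoot b ∧ f₂.IsRoot b ∧ g.IsRoot b
  · obtain ⟨b, hb₁, hb₂, hb⟩ := hcommon
    obtain ⟨u₁, rfl⟩ := dvd_iff_isRoot.2 hb₁
    obtain ⟨u₂, rfl⟩ := dvd_iff_isRoot.2 hb₂
    obtain ⟨v, rfl⟩ := dvd_iff_isRoot.2 hb
    rw [countInterleaves_X_sub_C_mul_iff] at h₁ h₂
    rw [← mul_add, countInterleaves_X_sub_C_mul_iff]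
    refine ih v.natDegree ?_ h₁ h₂ rfl
    rw [← hd, natDegree_mul (X_sub_C_ne_zero b) h₁.ne_zero_right, natDegree_X_sub_C]
    omega
  have hne : ∀ b ∈ g.roots, f₁.eval b ≠ 0 ∨ f₂.eval b ≠ 0 := by
    intro b hb
    by_contra! h
    exact hcommon ⟨b, h.1, h.2, (mem_roots'.1 hb).2⟩
  obtain ⟨hlc, hdeg⟩ := leadingCoeff_add_pos h₁.lc_left h₂.lc_left
  refine .of_sign_at_roots h₁.splits_right h₁.lc_right hlc ?_ ?_ ?_
  · have := h₁.natDegree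
    have := h₂.natDegree
    omega
  · rw [Multiset.nodup_iff_count_le_one]
    intro b
    by_cases hb : b ∈ g.roots
    · rcases hne b hb with h | h
      · exact (h₁.sign_at_root hb h).2
      · exact (h₂.sign_at_root hb h).2
    · simp [Multiset.count_eq_zero.2 hb]
  · intro b hb
    rw [eval_add, mul_add]
    by_cases h1 : f₁.eval b = 0
    · have h2 := (hne b hb).resolve_left (not_not.2 h1)
      simpa [h1] using (h₂.sign_at_root hb h2).1
    · have h1' := (h₁.sign_at_root hb h1).1
      by_cases h2 : f₂.eval b = 0
      · simpa [h2] using h1'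
      · exact add_pos h1' (h₂.sign_at_root hb h2).1

theorem Interleaves.add_left {f₁ f₂ g : ℝ[X]} (h₁ : Interleaves f₁ g) (h₂ : Interleaves f₂ g) :
    Interleaves (f₁ + f₂) g := by
  by_cases hf₁ : f₁ = 0
  · simpa [hf₁] using h₂
  by_cases hf₂ : f₂ = 0
  · simpa [hf₂] using h₁
  by_cases hg : g = 0
  · exact Or.inr (Or.inl hg)
  rw [interleaves_iff, or_iff_right, or_iff_right hg] at h₁ h₂
  · exact (h₁.add_left h₂).interleaves
  all_goals assumption

theorem coeff_add_nonneg {f g : ℝ[X]} (hf : ∀ k, 0 ≤ f.coeff k) (hg : ∀ k, 0 ≤ g.coeff k) (k : ℕ) :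
    0 ≤ (f + g).coeff k := by
  rw [coeff_add]; exact add_nonneg (hf k) (hg k)

theorem coeff_sum_nonneg {ι : Type*} {s : Finset ι} {u : ι → ℝ[X]}
    (hu : ∀ i ∈ s, ∀ k, 0 ≤ (u i).coeff k) (k : ℕ) : 0 ≤ (∑ i ∈ s, u i).coeff k := by
  rw [finsetSum_coeff]; exact Finset.sum_nonneg fun i hi => hu i hi k

theorem coeff_X_mul_nonneg {f : ℝ[X]} (hf : ∀ k, 0 ≤ f.coeff k) (k : ℕ) : 0 ≤ (X * f).coeff k := by
  cases k with
  | zero => simp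
  | succ k => rw [coeff_X_mul]; exact hf k

theorem Interleaves.add_right {f g₁ g₂ : ℝ[X]} (hf : ∀ k, 0 ≤ f.coeff k)
    (hg₁ : ∀ k, 0 ≤ g₁.coeff k) (hg₂ : ∀ k, 0 ≤ g₂.coeff k)
    (h₁ : Interleaves f g₁) (h₂ : Interleaves f g₂) : Interleaves f (g₁ + g₂) := by
  rw [← interleaves_X_mul_iff hf (coeff_add_nonneg hg₁ hg₂)]
  rw [← interleaves_X_mul_iff hf hg₁] at h₁
  rw [← interleaves_X_mul_iff hf hg₂] at h₂
  exact h₁.add_left h₂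

theorem Interleaves.sum_left {ι : Type*} {s : Finset ι} {u : ι → ℝ[X]} {g : ℝ[X]}
    (h : ∀ i ∈ s, Interleaves (u i) g) : Interleaves (∑ i ∈ s, u i) g :=
  Finset.sum_induction u (Interleaves · g) (fun _ _ h₁ h₂ => h₁.add_left h₂) (Or.inl rfl) h

theorem Interleaves.sum_right {ι : Type*} {s : Finset ι} {v : ι → ℝ[X]} {f : ℝ[X]}
    (hf : ∀ k, 0 ≤ f.coeff k) (hv : ∀ i ∈ s, ∀ k, 0 ≤ (v i).coeff k)
    (h : ∀ i ∈ s, Interleaves f (v i)) : Interleaves f (∑ i ∈ s, v i) := by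
  refine (Finset.sum_induction v (fun g => Interleaves f g ∧ ∀ k, 0 ≤ g.coeff k) ?_ ?_
    fun i hi => ⟨h i hi, hv i hi⟩).1
  · exact fun _ _ h₁ h₂ => ⟨.add_right hf h₁.2 h₂.2 h₁.1 h₂.1, coeff_add_nonneg h₁.2 h₂.2⟩
  · exact ⟨Or.inr (Or.inl rfl), by simp⟩

/-- Adding `f ≪ g` and `g ≪ g` gives `f + g ≪ g`. -/
theorem Interleaves.splits_add {f g : ℝ[X]} (h : Interleaves f g) (hf : f.Splits) (hg : g.Splits)
    (hgc : ∀ k, 0 ≤ g.coeff k) : (f + g).Splits := by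
  by_cases hg0 : g = 0
  · simpa [hg0] using hf
  rcases h.add_left (.refl hg hgc) with h | h | h
  · rw [h]; exact .zero
  · exact absurd h hg0
  · exact h.1

/-! ### Entries and forbidden patterns -/

/-- The polynomials `0`, `1`, `x`. -/
noncomputable def monomialEntry (c : Fin 3) : ℝ[X] := ![0, 1, X] c

theorem monomialEntry_zero : monomialEntry 0 = 0 := rfl
theorem monomialEntry_one : monomialEntry 1 = 1 := rfl
theorem monomialEntry_two : monomialEntry 2 = X := rfl

theorem coeff_monomialEntry_mul_nonneg (c : Fin 3) {f : ℝ[X]} (hf : ∀ k, 0 ≤ f.coeff k) (k : ℕ) :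
    0 ≤ (monomialEntry c * f).coeff k := by
  fin_cases c
  · simp [monomialEntry]
  · simpa [monomialEntry] using hf k
  · simpa [monomialEntry] using coeff_X_mul_nonneg hf k

/-- The sum of the members of the sequence `f` weighted by entries in `{0, 1, x}`. -/
noncomputable def rowSum {n : ℕ} (f : Fin n → ℝ[X]) (a : Fin n → Fin 3) : ℝ[X] :=
  ∑ i, monomialEntry (a i) * f i

/-- `EntryLE o c d` says that `c f ≪ d g` for entries `c, d ∈ {0, 1, x}`, whenever `f = g`
(`o = .eq`), `f ≪ g` (`o = .lt`) or `g ≪ f` (`o = .gt`). -/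
def EntryLE (o : Ordering) (c d : Fin 3) : Prop :=
  ¬ (c = 2 ∧ d = 1) ∧ (o = .lt → ¬ (c = 1 ∧ d = 2)) ∧
    (o = .gt → ¬ (c = 1 ∧ d = 1) ∧ ¬ (c = 2 ∧ d = 2))

instance (o : Ordering) (c d : Fin 3) : Decidable (EntryLE o c d) := by
  unfold EntryLE; infer_instance

/-- The conditions on a `2 × 2` matrix with entries in `{0, 1, x}` (encoded as `0`, `1`, `2`) which
say that it is not forbidden. -/
def Admissible (p q r s : Fin 3) : Prop :=
  ¬ (p = 2 ∧ r = 1) ∧ ¬ (q = 2 ∧ s = 1) ∧ ¬ (p = 1 ∧ q = 2) ∧ ¬ (r = 1 ∧ s = 2) ∧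
  (p = 1 → s = 2 → q = 1 ∧ r = 2) ∧ (p = 2 → s = 1 → q = 1 ∧ r = 2) ∧ ¬ (q = 2 ∧ r = 1) ∧
  (q = 1 → r = 1 → p ≠ 2 → s ≠ 2 → p = 1 ∧ s = 1) ∧
  (q = 2 → r = 2 → p ≠ 1 → s ≠ 1 → p = 2 ∧ s = 2)

set_option synthInstance.maxSize 1024 in
instance (p q r s : Fin 3) : Decidable (Admissible p q r s) := by
  unfold Admissible; infer_instance

theorem monomialEntry_injective : Function.Injective monomialEntry := by
  intro c d h
  have h01 : (X : ℝ[X]) ≠ 1 := fun h => by simpa using congrArg natDegree h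
  fin_cases c <;> fin_cases d <;> simp [monomialEntry, h01, h01.symm, X_ne_zero.symm] at h ⊢

/-- A `0`-`1` matrix has negative determinant exactly when both antidiagonal entries are `1` and
some diagonal entry is `0`. -/
theorem admissible_of_not_isForbidden {p q r s : Fin 3}
    (h : ¬ IsForbidden !![monomialEntry p, monomialEntry q; monomialEntry r, monomialEntry s]) :
    Admissible p q r s := by
  have inj {c d : Fin 3} : monomialEntry c = monomialEntry d ↔ c = d :=
    monomialEntry_injective.eq_iff
  have e1 := monomialEntry_one
  have e2 := monomialEntry_two
  refine ⟨?_, ?_, ?_, ?_, ?_, ?_, ?_, ?_, ?_⟩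
  · rintro ⟨rfl, rfl⟩; exact h (.col_left _ _)
  · rintro ⟨rfl, rfl⟩; exact h (.col_right _ _)
  · rintro ⟨rfl, rfl⟩; exact h (.row_top _ _)
  · rintro ⟨rfl, rfl⟩; exact h (.row_bottom _ _)
  · rintro rfl rfl
    by_contra hc
    exact h (.diag_one_X _ _ (by rwa [← e1, ← e2, inj, inj]))
  · rintro rfl rfl
    by_contra hc
    exact h (.diag_X_one _ _ (by rwa [← e1, ← e2, inj, inj]))
  · rintro ⟨rfl, rfl⟩; exact h (.antidiag _ _)
  · rintro rfl rfl hp hs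
    by_contra hc
    -- The last value is junk: the entry `x` does not occur here.
    let v : Fin 3 → ℝ := ![0, 1, 0]
    have hv (c : Fin 3) (hc : c ≠ 2) : C (v c) = monomialEntry c := by
      fin_cases c <;> simp_all [v, monomialEntry]
    have h01 (c : Fin 3) : v c = 0 ∨ v c = 1 := by fin_cases c <;> simp [v]
    refine h ?_
    have := IsForbidden.zero_one !![v p, v 1; v 1, v s]
      (by intro i j; fin_cases i <;> fin_cases j <;> simp [h01]) (by
        rw [Matrix.det_fin_two_of]
        fin_cases p <;> fin_cases s <;> simp_all [v])
    convert this using 1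
    ext1 i j
    fin_cases i <;> fin_cases j <;> simp [hv, hp, hs]
  · rintro rfl rfl hp hs
    by_contra hc
    -- Here the middle value is junk, since the entry `1` does not occur.
    let v : Fin 3 → ℝ := ![0, 0, 1]
    have hv (c : Fin 3) (hc : c ≠ 1) : X * C (v c) = monomialEntry c := by
      fin_cases c <;> simp_all [v, monomialEntry]
    have h01 (c : Fin 3) : v c = 0 ∨ v c = 1 := by fin_cases c <;> simp [v]
    refine h ?_
    have := IsForbidden.X_mul_zero_one !![v p, v 2; v 2, v s]
      (by intro i j; fin_cases i <;> fin_cases j <;> simp [h01]) (by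
        rw [Matrix.det_fin_two_of]
        fin_cases p <;> fin_cases s <;> simp_all [v])
    convert this using 1
    ext1 i j
    fin_cases i <;> fin_cases j <;> simp [hv, hp, hs]

/-! ### Images under one and two rows -/

theorem coeff_rowSum_nonneg {n : ℕ} {f : Fin n → ℝ[X]} (hf : f ∈ interlacingFamilyNonneg n)
    (a : Fin n → Fin 3) (k : ℕ) : 0 ≤ (rowSum f a).coeff k :=
  coeff_sum_nonneg (fun i _ => coeff_monomialEntry_mul_nonneg (a i) (hf.2 i)) k

theorem interleaves_monomialEntry_mul {n : ℕ} {f : Fin n → ℝ[X]}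
    (hf : f ∈ interlacingFamilyNonneg n) (c d : Fin 3) (i j : Fin n)
    (h : EntryLE (compare i j) c d) :
    Interleaves (monomialEntry c * f i) (monomialEntry d * f j) := by
  obtain ⟨⟨hs, hi⟩, hn⟩ := hf
  have hle : ∀ i j, i ≤ j → Interleaves (f i) (f j) := fun i j hij => by
    rcases hij.lt_or_eq with hij | rfl
    · exact hi i j hij
    · exact .refl (hs i) (hn i)
  obtain ⟨h1, h2, h3⟩ := h
  rw [compare_lt_iff_lt] at h2
  rw [compare_gt_iff_gt] at h3
  have hcases : c = 0 ∨ d = 0 ∨ (c = d ∧ i ≤ j) ∨ (c = 1 ∧ d = 2 ∧ j ≤ i) := by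
    rw [← not_lt, ← not_lt]
    generalize (i < j) = P at *
    generalize hQ : (j < i) = Q at *
    by_cases hP : P <;> by_cases hQ' : Q <;> simp only [hP, hQ', hQ] at * <;>
      revert h1 h2 h3 <;> revert c d <;> decide
  rcases hcases with rfl | rfl | ⟨rfl, hij⟩ | ⟨rfl, rfl, hij⟩
  · exact Or.inl (by rw [monomialEntry_zero, zero_mul])
  · exact Or.inr (Or.inl (by rw [monomialEntry_zero, zero_mul]))
  · fin_cases c
    · exact Or.inl (zero_mul _)
    · simpa [monomialEntry] using hle i j hij
    · simpa [monomialEntry] using (hle i j hij).X_mul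
  · rw [monomialEntry_one, monomialEntry_two, one_mul, interleaves_X_mul_iff (hn _) (hn _)]
    exact hle j i hij

theorem interleaves_rowSum {n : ℕ} {f : Fin n → ℝ[X]} (hf : f ∈ interlacingFamilyNonneg n)
    (a b : Fin n → Fin 3) (h : ∀ i j, EntryLE (compare i j) (a i) (b j)) :
    Interleaves (rowSum f a) (rowSum f b) :=
  .sum_left fun i _ => .sum_right (coeff_monomialEntry_mul_nonneg _ (hf.2 i))
    (fun j _ => coeff_monomialEntry_mul_nonneg _ (hf.2 j))
    fun j _ => interleaves_monomialEntry_mul hf _ _ i j (h i j)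

theorem splits_sum {n : ℕ} {f : Fin n → ℝ[X]} (hf : f ∈ interlacingFamilyNonneg n)
    (s : Finset (Fin n)) : (∑ i ∈ s, f i).Splits := by
  induction s using Finset.induction_on_max with
  | empty => rw [Finset.sum_empty]; exact .zero
  | insert a s ha ih =>
    rw [Finset.sum_insert fun h => lt_irrefl _ (ha a h), add_comm]
    exact Interleaves.splits_add (.sum_left fun i hi => hf.1.2 i a (ha i hi)) ih (hf.1.1 a) (hf.2 a)

/-- If no entry `1` precedes an entry `x` in a row, then the row maps interlacing sequences to
real-rooted polynomials. -/
theorem splits_rowSum {n : ℕ} {f : Fin n → ℝ[X]} (hf : f ∈ interlacingFamilyNonneg n)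
    (a : Fin n → Fin 3) (ha : ∀ i j, i < j → ¬ (a i = 1 ∧ a j = 2)) : (rowSum f a).Splits := by
  have hsub (b : Fin n → Fin 3) (c : Fin 3) (hb : ∀ i, b i = 0 ∨ b i = c) :
      rowSum f b = monomialEntry c * ∑ i ∈ Finset.univ.filter (b · = c), f i := by
    rw [rowSum, Finset.mul_sum, Finset.sum_filter]
    refine Finset.sum_congr rfl fun i _ => ?_
    split_ifs with h
    · rw [h]
    · rw [(hb i).resolve_right h, monomialEntry_zero, zero_mul]
  -- Every `x` precedes every `1`, so `f j ≪ f i` yields `f i ≪ x * f j` for each `1` at `i` and `x`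
  -- at `j`. Hence the `1`-part interlaces the `x`-part, and their sum is real-rooted.
  have hsplit : rowSum f a = rowSum f (fun i => if a i = 1 then 1 else 0) +
      rowSum f (fun i => if a i = 2 then 2 else 0) := by
    rw [rowSum, rowSum, rowSum, ← Finset.sum_add_distrib]
    refine Finset.sum_congr rfl fun i _ => ?_
    rw [← add_mul]
    congr 1
    generalize a i = c
    fin_cases c <;> simp [monomialEntry]
  rw [hsplit]
  refine Interleaves.splits_add (interleaves_rowSum hf _ _ fun i j => ?_) ?_ ?_
    (coeff_rowSum_nonneg hf _)
  · have := ha i j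
    rw [← compare_lt_iff_lt] at this
    generalize compare i j = o at *
    revert this
    generalize a i = c
    generalize a j = d
    revert o c d
    decide
  · rw [hsub _ 1 fun i => by by_cases h : a i = 1 <;> simp [h], monomialEntry_one, one_mul]
    exact splits_sum hf _
  · rw [hsub _ 2 fun i => by by_cases h : a i = 2 <;> simp [h], monomialEntry_two]
    exact Splits.X.mul (splits_sum hf _)

/-- The image of an interlacing sequence under two rows without forbidden submatrices. -/
theorem interleaves_rowSum_of_admissible {n : ℕ} {f : Fin n → ℝ[X]}
    (hf : f ∈ interlacingFamilyNonneg n) (hn : 2 ≤ n) (a b : Fin n → Fin 3)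
    (hab : ∀ i j, i < j → Admissible (a i) (a j) (b i) (b j)) :
    Interleaves (rowSum f a) (rowSum f b) := by
  -- On columns other than `x` above `1`, the upper row is `left + shift + common`, the lower one
  -- `common + right + shift'`, and `left` and `right` are never both nonzero.
  let common (c d : Fin 3) : Fin 3 := if c = d then c else 0
  let shift (c d : Fin 3) : Fin 3 := if c = 1 ∧ d = 2 then 1 else 0
  let shift' (c d : Fin 3) : Fin 3 := if c = 1 ∧ d = 2 then 2 else 0
  let left (c d : Fin 3) : Fin 3 := if c = d ∨ c = 1 ∧ d = 2 then 0 else c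
  let right (c d : Fin 3) : Fin 3 := if c = d ∨ c = 1 ∧ d = 2 then 0 else d
  let row (u : Fin 3 → Fin 3 → Fin 3) : ℝ[X] := rowSum f fun i => u (a i) (b i)
  have ha : rowSum f a = row left + row shift + row common := by
    simp only [row, rowSum, ← Finset.sum_add_distrib, ← add_mul]
    refine Finset.sum_congr rfl fun i _ => ?_
    congr 1
    generalize a i = c
    generalize b i = d
    fin_cases c <;> fin_cases d <;> simp [monomialEntry, left, shift, common]
  have hb : rowSum f b = row common + (row right + row shift') := by
    simp only [row, rowSum, ← Finset.sum_add_distrib, ← add_mul]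
    refine Finset.sum_congr rfl fun i _ => ?_
    congr 1
    generalize a i = c
    generalize b i = d
    fin_cases c <;> fin_cases d <;> simp [monomialEntry, right, shift', common]
  have hshift : row shift' = X * row shift := by
    simp only [row, rowSum, Finset.mul_sum, ← mul_assoc]
    refine Finset.sum_congr rfl fun i _ => ?_
    congr 1
    generalize a i = c
    generalize b i = d
    fin_cases c <;> fin_cases d <;> simp [monomialEntry, shift, shift']
  have hpos (u) : ∀ k, 0 ≤ (row u).coeff k := coeff_rowSum_nonneg hf _
  -- As `n ≥ 2`, every column belongs to some pair.
  have hcol : ∀ i, ¬ (a i = 2 ∧ b i = 1) := by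
    intro i
    obtain ⟨j, hj⟩ : ∃ j : Fin n, j ≠ i := by
      have : Nontrivial (Fin n) := Fin.nontrivial_iff_two_le.2 hn
      exact exists_ne i
    rcases lt_or_gt_of_ne hj with h | h
    · exact (hab j i h).2.1
    · exact (hab i j h).1
  have key (u v : Fin 3 → Fin 3 → Fin 3)
      (h1 : ∀ p q r s, Admissible p q r s → EntryLE .lt (u p r) (v q s) ∧ EntryLE .gt (u q s) (v p r))
      (h2 : ∀ c d, ¬ (c = 2 ∧ d = 1) → EntryLE .eq (u c d) (v c d)) :
      Interleaves (row u) (row v) := by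
    refine interleaves_rowSum hf _ _ fun i j => ?_
    rcases lt_trichotomy i j with h | rfl | h
    · rw [compare_lt_iff_lt.2 h]; exact (h1 _ _ _ _ (hab i j h)).1
    · rw [compare_eq_iff_eq.2 rfl]; exact h2 _ _ (hcol i)
    · rw [compare_gt_iff_gt.2 h]; exact (h1 _ _ _ _ (hab j i h)).2
  have hsplits (u : Fin 3 → Fin 3 → Fin 3)
      (hu : ∀ p q r s, Admissible p q r s → ¬ (u p r = 1 ∧ u q s = 2)) : (row u).Splits :=
    splits_rowSum hf _ fun i j hij => hu _ _ _ _ (hab i j hij)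
  -- This relation and the next can fail term by term; real-rootedness of the whole block replaces
  -- the termwise check.
  have hss : Interleaves (row shift) (row shift') := by
    rw [hshift, interleaves_X_mul_iff (hpos _) (hpos _)]
    exact .refl (hsplits _ (by decide)) (hpos _)
  have hcc : Interleaves (row common) (row common) := .refl (hsplits _ (by decide)) (hpos _)
  have hlr : Interleaves (row left) (row right) := key _ _ (by decide) (by decide)
  have hls : Interleaves (row left) (row shift') := key _ _ (by decide) (by decide)
  have hlc : Interleaves (row left) (row common) := key _ _ (by decide) (by decide)
  have hsr : Interleaves (row shift) (row right) := key _ _ (by decide) (by decide)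
  have hsc : Interleaves (row shift) (row common) := key _ _ (by decide) (by decide)
  have hcr : Interleaves (row common) (row right) := key _ _ (by decide) (by decide)
  have hcs : Interleaves (row common) (row shift') := key _ _ (by decide) (by decide)
  have hright : ∀ k, 0 ≤ (row right + row shift').coeff k := coeff_add_nonneg (hpos _) (hpos _)
  rw [ha, hb]
  refine .add_left (.add_left ?_ ?_) ?_
  · exact .add_right (hpos _) (hpos _) hright hlc (.add_right (hpos _) (hpos _) (hpos _) hlr hls)
  · exact .add_right (hpos _) (hpos _) hright hsc (.add_right (hpos _) (hpos _) (hpos _) hsr hss)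
  · exact .add_right (hpos _) (hpos _) hright hcc (.add_right (hpos _) (hpos _) (hpos _) hcr hcs)

theorem theorem3p4 (m n : ℕ) (hm : 2 ≤ m) (hn : 2 ≤ n) (G : Matrix (Fin m) (Fin n) ℝ[X])
    (hG : ∀ i j, G i j = 0 ∨ G i j = 1 ∨ G i j = X)
    (hforb : ∀ (k l : Fin m) (i j : Fin n), k < l → i < j →
      ¬ IsForbidden (G.submatrix ![k, l] ![i, j])) :
    Set.MapsTo (fun f : Fin n → ℝ[X] => G.mulVec f)
      (interlacingFamilyNonneg n) (interlacingFamilyNonneg m) := by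
  have hG' : ∀ k i, ∃ c, G k i = monomialEntry c := fun k i => by
    rcases hG k i with h | h | h
    exacts [⟨0, h⟩, ⟨1, h⟩, ⟨2, h⟩]
  choose e he using hG'
  have hadm : ∀ k l i j, k < l → i < j → Admissible (e k i) (e k j) (e l i) (e l j) := by
    intro k l i j hkl hij
    refine admissible_of_not_isForbidden ?_
    convert hforb k l i j hkl hij using 2
    ext1 p q
    fin_cases p <;> fin_cases q <;> simp [he]
  intro f hf
  have hrow : ∀ k, G.mulVec f k = rowSum f (e k) := fun k => by
    simp only [Matrix.mulVec, dotProduct, rowSum, he]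
  refine ⟨⟨fun k => ?_, fun k l hkl => ?_⟩, fun k => ?_⟩
  · simp only [hrow]
    refine splits_rowSum hf _ fun i j hij => ?_
    -- A second row is needed to see row `k` inside a `2 × 2` submatrix.
    obtain ⟨l, hl⟩ : ∃ l : Fin m, l ≠ k := by
      have : Nontrivial (Fin m) := Fin.nontrivial_iff_two_le.2 hm
      exact exists_ne k
    rcases lt_or_gt_of_ne hl with h | h
    · exact (hadm l k i j h hij).2.2.2.1
    · exact (hadm k l i j h hij).2.2.1
  · simp only [hrow]
    exact interleaves_rowSum_of_admissible hf hn _ _ fun i j hij => hadm k l i j hkl hij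
  · simp only [hrow]
    exact coeff_rowSum_nonneg hf _
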